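/- **Setting.** Let $\Sigma=\langle S,F,R,Ax\rangle$ consist of a many-sorted first-order signature (sorts $S$, function symbols $F$, relation symbols $R$, with countably many variables of each sort) and of axiom symbols $a\colon A_a\to B_a$, where $A_a,B_a$ are closed formulae. Formulae (equivalently, λ-types) are built from $\bot,\top$ (written $0,1$), atomic formulae, $\wedge,\vee,\supset$ (written $\times,+,\to$) and $\forall x{:}s$, $\exists x{:}s$; they may have free variables, are identified up to renaming of bound variables, and $A[t/x]$ is capture-avoiding substitution. *Proofs.* $\Gamma\vdash A$ means that $A$ has a proof in intuitionistic natural deduction from the assumptions $\Gamma$ and the axioms $A_a\supset B_a$ ($a\in Ax$), by the usual introduction and elimination rules, with eigenvariable conditions: in $\forall$-introduction, $x\notin FV(\Gamma)$; in $\exists$-elimination (from $\exists x{:}s.B$ and $B\supset A$ infer $A$), $x\notin FV(\Gamma)\cup FV(A)$. The λ-terms over $\Sigma$ are the proof terms: typed variables, $a(t)$ for $a\in Ax$, pairing and projections, injections and case analysis, abstraction and application, $*:1$, $F_A:0\to A$, and introduction and elimination terms for $\forall$ and $\exists$, where in $\forall$-introduction from $t:A$ the variable $x$ must not be free in the type of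 any free variable of $t$, and in $\exists$-elimination from $t:\exists x{:}s.A$ and $r:A\to B$ it must not be free in $B$ nor in the type of any free variable of $r$. A term-in-context $x{:}B.\,t:A$ is a λ-term $t$ of type $A$ with no free typed variable other than $x:B$. *Models.* A logically distributive category is a category $\mathbb C$ with finite products, finite coproducts and exponentials, in which the canonical arrows $(X\times Y)+(X\times Z)\to X\times(Y+Z)$ are invertible, together with a map $M$ from formulae to objects of $\mathbb C$ such that: $M0$ is initial; $M1$ is terminal; $M(A\times B)$, $M(A+B)$, $M(A\to B)$ are the product $MA\times MB$, the coproduct $MA+MB$ and the exponential $MB^{MA}$; $M(\forall x{:}s.A)$ carries a cone over the family $\bigl(M(A[t/x])\bigr)_t$, indexed by all logical terms $t$ of sort $s$, which is terminal among all cones over this family with a vertex of the form $MB$, $x\notin FV(B)$; dually, $M(\exists x{:}s.A)$ carries a cocone under this family, which is initial among all cocones with a vertex $MB$, $x\notin FV(B)$; and for $x\notin FV(A)$ the canonical arrow $M(\exists x{:}s.A\times B)\to MA\times M(\exists x{:}s.B)$ is invertible. A model $\mathcal N$ is a logically distributive category $(\mathbb N,N)$ together with an arrow $NA_a\to NB_a$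 for each $a\in Ax$. A formula $A$ is a *logical consequence* of $B_1,\dots,B_n$ if in every model $\mathcal N$, in every logically distributive category, there is an arrow $N(B_1\times\dots\times B_n)\to NA$ (for $n=0$ the product is $1$). **Theorem.** For all formulae $A,B_1,\dots,B_n$ ($n\ge 0$) over $\Sigma$: 1. $A$ is a logical consequence of $B_1,\dots,B_n$ if and only if there is a term-in-context $x{:}B_1\times\dots\times B_n.\;t:A$; 2. $A$ is a logical consequence of $B_1,\dots,B_n$ if and only if $B_1,\dots,B_n\vdash A$ in first-order intuitionistic logic. -/

import Mathlib

open CategoryTheory CategoryTheory.Limits MonoidalCategory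

universe u v w

namespace FirstOrderLD

/-- A many-sorted first-order signature: sorts, function symbols `f : s₁ × ⋯ × sₙ → s₀` and
relation symbols `r : s₁ × ⋯ × sₙ`. -/
structure LogicalSignature where
  /-- sort symbols -/
  Srt : Type u
  /-- function symbols -/
  Fn : Type u
  /-- the sorts of the arguments of a function symbol -/
  fnDom : Fn → List Srt
  /-- the sort of the value of a function symbol -/
  fnCod : Fn → Srt
  /-- relation symbols -/
  Rel : Type u
  /-- the sorts of the arguments of a relation symbol -/
  relDom : Rel → List Srt

/-- `BVar Γ s`: the positions of the list `Γ` at which the sort `s` stands. They serve as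
(nameless) bound variables, so that expressions are literally identified up to renaming of
bound variables. -/
inductive BVar {S : Type u} : List S → S → Type u
  | here {Γ : List S} {s : S} : BVar (s :: Γ) s
  | there {Γ : List S} {s s' : S} (i : BVar Γ s) : BVar (s' :: Γ) s

variable (L : LogicalSignature.{u})

/-- A named variable: its sort `s` together with its name; the set `V_s` of variables of
sort `s` is a copy of `ℕ`. -/
abbrev LVar : Type u := L.Srt × ℕ

/-- Terms with named free variables, and with bound variables taken from `Γ`. -/
inductive Term (Γ : List L.Srt) : L.Srt → Type u
  | fvar {s : L.Srt} (n : ℕ) : Term Γ s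
  | bvar {s : L.Srt} (i : BVar Γ s) : Term Γ s
  | app (f : L.Fn) (ts : ∀ i : Fin (L.fnDom f).length, Term Γ ((L.fnDom f).get i)) :
      Term Γ (L.fnCod f)

/-- Formulae (equivalently, λ-types: the constructors `bot, top, and, or, imp, all, ex` are
written `0, 1, ×, +, →, ∀, ∃` there) with named free variables and with bound variables taken
from `Γ`. A quantifier adds one bound variable. -/
inductive Formula : List L.Srt → Type u
  | bot {Γ : List L.Srt} : Formula Γ
  | top {Γ : List L.Srt} : Formula Γ
  | rel {Γ : List L.Srt} (r : L.Rel)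
      (ts : ∀ i : Fin (L.relDom r).length, Term L Γ ((L.relDom r).get i)) : Formula Γ
  | and {Γ : List L.Srt} (A B : Formula Γ) : Formula Γ
  | or {Γ : List L.Srt} (A B : Formula Γ) : Formula Γ
  | imp {Γ : List L.Srt} (A B : Formula Γ) : Formula Γ
  | all {Γ : List L.Srt} (s : L.Srt) (A : Formula (s :: Γ)) : Formula Γ
  | ex {Γ : List L.Srt} (s : L.Srt) (A : Formula (s :: Γ)) : Formula Γ

/-- The logical terms of sort `s`: no bound variable is left dangling. -/
abbrev LTerm (s : L.Srt) : Type u := Term L [] s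

/-- The logical formulae, which are also the λ-types. -/
abbrev LForm : Type u := Formula L []

variable {L}

/-- Free variables of a term. -/
def Term.FV {Γ : List L.Srt} : {s : L.Srt} → Term L Γ s → Set (LVar L)
  | s, .fvar n => {(s, n)}
  | _, .bvar _ => ∅
  | _, .app _ ts => ⋃ i, (ts i).FV

/-- Free variables of a formula. -/
def Formula.FV : {Γ : List L.Srt} → Formula L Γ → Set (LVar L)
  | _, .bot => ∅
  | _, .top => ∅
  | _, .rel _ ts => ⋃ i, (ts i).FV
  | _, .and A B => A.FV ∪ B.FV
  | _, .or A B => A.FV ∪ B.FV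
  | _, .imp A B => A.FV ∪ B.FV
  | _, .all _ A => A.FV
  | _, .ex _ A => A.FV

/-- Simultaneous replacement of the free variables (by `φ`) and of the bound variables (by `β`)
of a term. -/
def Term.bind {Γ Δ : List L.Srt} (φ : ∀ s, ℕ → Term L Δ s) (β : ∀ s, BVar Γ s → Term L Δ s) :
    {s : L.Srt} → Term L Γ s → Term L Δ s
  | s, .fvar n => φ s n
  | s, .bvar i => β s i
  | _, .app f ts => .app f fun i => (ts i).bind φ β

/-- Regard a term as a term below one more quantifier. -/
def Term.weaken {Γ : List L.Srt} (s' : L.Srt) {s : L.Srt} (t : Term L Γ s) :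
    Term L (s' :: Γ) s :=
  t.bind (fun _ n => .fvar n) (fun _ i => .bvar i.there)

/-- The replacement of bound variables carried below one more quantifier. -/
def liftBound {Γ Δ : List L.Srt} (β : ∀ s, BVar Γ s → Term L Δ s) (s' : L.Srt) :
    ∀ s, BVar (s' :: Γ) s → Term L (s' :: Δ) s
  | _, .here => .bvar .here
  | s, .there i => (β s i).weaken s'

/-- Simultaneous capture-avoiding replacement of the free variables (by `φ`) and of the bound
variables (by `β`) of a formula. -/
def Formula.bind : {Γ Δ : List L.Srt} → (∀ s, ℕ → Term L Δ s) →
    (∀ s, BVar Γ s → Term L Δ s) → Formula L Γ → Formula L Δ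
  | _, _, _, _, .bot => .bot
  | _, _, _, _, .top => .top
  | _, _, φ, β, .rel r ts => .rel r fun i => (ts i).bind φ β
  | _, _, φ, β, .and A B => .and (A.bind φ β) (B.bind φ β)
  | _, _, φ, β, .or A B => .or (A.bind φ β) (B.bind φ β)
  | _, _, φ, β, .imp A B => .imp (A.bind φ β) (B.bind φ β)
  | _, _, φ, β, .all s A => .all s (A.bind (fun s' n => (φ s' n).weaken s) (liftBound β s))
  | _, _, φ, β, .ex s A => .ex s (A.bind (fun s' n => (φ s' n).weaken s) (liftBound β s))

open Classical in
/-- The assignment sending the variable `x` of sort `s` to `t`, and every other variable to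
itself. -/
noncomputable def single {Γ : List L.Srt} {s : L.Srt} (x : ℕ) (t : Term L Γ s) :
    ∀ s', ℕ → Term L Γ s' :=
  fun s' y => if h : s = s' ∧ x = y then h.1 ▸ t else .fvar y

/-- Substitution `A[t/x]` of the logical term `t : s` for the variable `x : s`. -/
noncomputable def LForm.subst {s : L.Srt} (x : ℕ) (t : LTerm L s) (A : LForm L) : LForm L :=
  A.bind (single x t) (fun _ i => .bvar i)

/-- Turn the free occurrences of the variable `x : s` into a bound variable. -/
noncomputable def LForm.close (s : L.Srt) (x : ℕ) (A : LForm L) : Formula L [s] :=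
  A.bind (single x (.bvar .here)) (fun _ i => .bvar i.there)

/-- The formula `∀ x : s. A`. -/
noncomputable def LForm.all (s : L.Srt) (x : ℕ) (A : LForm L) : LForm L :=
  Formula.all s (A.close s x)

/-- The formula `∃ x : s. A`. -/
noncomputable def LForm.ex (s : L.Srt) (x : ℕ) (A : LForm L) : LForm L :=
  Formula.ex s (A.close s x)

/-- The product (conjunction) `B₁ × ⋯ × Bₙ`, which is `1` for `n = 0` and `B₁` for `n = 1`. -/
def LForm.prod : List (LForm L) → LForm L
  | [] => .top
  | [B] => B
  | B :: B' :: Bs => .and B (LForm.prod (B' :: Bs))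

lemma Term.bind_eq_self {Γ : List L.Srt} {φ : ∀ s, ℕ → Term L Γ s} :
    ∀ {s : L.Srt} (t : Term L Γ s), (∀ v ∈ t.FV, φ v.1 v.2 = .fvar v.2) →
      t.bind φ (fun _ i => .bvar i) = t
  | s, .fvar n, h => h (s, n) rfl
  | _, .bvar _, _ => rfl
  | _, .app f ts, h => by
      simp only [Term.bind]
      congr 1
      funext i
      exact Term.bind_eq_self (ts i) fun v hv => h v (Set.mem_iUnion.2 ⟨i, hv⟩)

lemma liftBound_bvar (Γ : List L.Srt) (s' : L.Srt) :
    liftBound (fun s (i : BVar Γ s) => (.bvar i : Term L Γ s)) s' = fun _ i => .bvar i := by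
  funext s i
  cases i <;> rfl

lemma Formula.bind_eq_self : ∀ {Γ : List L.Srt} {φ : ∀ s, ℕ → Term L Γ s} (A : Formula L Γ),
    (∀ v ∈ A.FV, φ v.1 v.2 = .fvar v.2) → A.bind φ (fun _ i => .bvar i) = A
  | _, _, .bot, _ => rfl
  | _, _, .top, _ => rfl
  | _, _, .rel r ts, h => by
      simp only [Formula.bind]
      congr 1
      funext i
      exact Term.bind_eq_self (ts i) fun v hv => h v (Set.mem_iUnion.2 ⟨i, hv⟩)
  | _, _, .and A B, h => by
      simp only [Formula.bind]
      rw [Formula.bind_eq_self A fun v hv => h v (Or.inl hv),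
        Formula.bind_eq_self B fun v hv => h v (Or.inr hv)]
  | _, _, .or A B, h => by
      simp only [Formula.bind]
      rw [Formula.bind_eq_self A fun v hv => h v (Or.inl hv),
        Formula.bind_eq_self B fun v hv => h v (Or.inr hv)]
  | _, _, .imp A B, h => by
      simp only [Formula.bind]
      rw [Formula.bind_eq_self A fun v hv => h v (Or.inl hv),
        Formula.bind_eq_self B fun v hv => h v (Or.inr hv)]
  | _, _, .all s A, h => by
      simp only [Formula.bind]
      rw [liftBound_bvar, Formula.bind_eq_self A fun v hv => by rw [h v hv]; rfl]
  | _, _, .ex s A, h => by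
      simp only [Formula.bind]
      rw [liftBound_bvar, Formula.bind_eq_self A fun v hv => by rw [h v hv]; rfl]

/-- `A[t/x] = A` if `x : s` is not free in `A`. -/
lemma LForm.subst_eq_self {s : L.Srt} {x : ℕ} (t : LTerm L s) {A : LForm L}
    (h : (s, x) ∉ A.FV) : LForm.subst x t A = A := by
  refine Formula.bind_eq_self A fun v hv => ?_
  refine dif_neg ?_
  rintro ⟨h1, h2⟩
  exact h ((Prod.ext h1 h2 : (s, x) = v) ▸ hv)

/-- A λ-signature: a logical signature together with axiom symbols `a : A → B`, where `A → B`
is a closed λ-type. -/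
structure LambdaSignature extends LogicalSignature.{u} where
  /-- axiom symbols -/
  Ax : Type u
  /-- the λ-type `A` of `a : A → B` -/
  axDom : Ax → LForm toLogicalSignature
  /-- the λ-type `B` of `a : A → B` -/
  axCod : Ax → LForm toLogicalSignature
  /-- the λ-type `A → B` has no free variable -/
  ax_closed : ∀ a, (Formula.imp (axDom a) (axCod a)).FV = ∅

/-- The λ-types over a λ-signature. They are the logical formulae. -/
abbrev LambdaSignature.LType (S : LambdaSignature.{u}) : Type u := LForm S.toLogicalSignature

/-- `Proves S Γ A`: the formula `A` has a natural deduction proof in first-order intuitionistic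
logic from the multiset `Γ` of assumptions and the axioms `A ⊃ B`, one for each axiom symbol
`a : A → B` of `S`. -/
inductive Proves (S : LambdaSignature.{u}) : Multiset S.LType → S.LType → Prop
  | assumption {Γ : Multiset S.LType} {A : S.LType} (h : A ∈ Γ) : Proves S Γ A
  | ax {Γ : Multiset S.LType} (a : S.Ax) : Proves S Γ (.imp (S.axDom a) (S.axCod a))
  | andI {Γ : Multiset S.LType} {B C : S.LType} :
      Proves S Γ B → Proves S Γ C → Proves S Γ (.and B C)
  | andE_left {Γ : Multiset S.LType} {A B : S.LType} : Proves S Γ (.and A B) → Proves S Γ A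
  | andE_right {Γ : Multiset S.LType} {A B : S.LType} : Proves S Γ (.and B A) → Proves S Γ A
  | orI_left {Γ : Multiset S.LType} {B C : S.LType} : Proves S Γ B → Proves S Γ (.or B C)
  | orI_right {Γ : Multiset S.LType} {B C : S.LType} : Proves S Γ C → Proves S Γ (.or B C)
  | orE {Γ : Multiset S.LType} {A B C : S.LType} :
      Proves S Γ (.or B C) → Proves S Γ (.imp B A) → Proves S Γ (.imp C A) → Proves S Γ A
  | impI {Γ : Multiset S.LType} {B C : S.LType} :
      Proves S (C ::ₘ Γ) B → Proves S Γ (.imp C B)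
  | impE {Γ : Multiset S.LType} {A B : S.LType} :
      Proves S Γ (.imp B A) → Proves S Γ B → Proves S Γ A
  | topI {Γ : Multiset S.LType} : Proves S Γ .top
  | botE {Γ : Multiset S.LType} {B : S.LType} : Proves S Γ (.imp .bot B)
  | allI {Γ : Multiset S.LType} {s : S.Srt} {x : ℕ} {B : S.LType}
      (hx : ∀ C ∈ Γ, (s, x) ∉ C.FV) : Proves S Γ B → Proves S Γ (LForm.all s x B)
  | allE {Γ : Multiset S.LType} {s : S.Srt} {x : ℕ} {B : S.LType}
      (t : LTerm S.toLogicalSignature s) :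
      Proves S Γ (LForm.all s x B) → Proves S Γ (LForm.subst x t B)
  | exI {Γ : Multiset S.LType} {s : S.Srt} {x : ℕ} {B : S.LType}
      (t : LTerm S.toLogicalSignature s) :
      Proves S Γ (LForm.subst x t B) → Proves S Γ (LForm.ex s x B)
  | exE {Γ : Multiset S.LType} {s : S.Srt} {x : ℕ} {A B : S.LType}
      (hx : ∀ C ∈ Γ, (s, x) ∉ C.FV) (hA : (s, x) ∉ A.FV) :
      Proves S Γ (LForm.ex s x B) → Proves S Γ (.imp B A) → Proves S Γ A

/-- Typed variables of the λ-calculus: a λ-type `A` together with a name; the set `W_A` of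
variables of type `A` is a copy of `ℕ`. -/
abbrev LambdaSignature.TVar (S : LambdaSignature.{u}) : Type u := S.LType × ℕ

/-- `LamTerm S V A`: the λ-terms of type `A` whose set of free typed variables is exactly `V`.
The side condition on quantifier rules, that the logical variable `x : s` is not free in the
type of any free typed variable of the term, is thus a condition on `V`. -/
inductive LamTerm (S : LambdaSignature.{u}) : Set S.TVar → S.LType → Type u
  | var (A : S.LType) (n : ℕ) : LamTerm S {(A, n)} A
  | ax {V : Set S.TVar} (a : S.Ax) (t : LamTerm S V (S.axDom a)) : LamTerm S V (S.axCod a)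
  | pair {V W : Set S.TVar} {A B : S.LType} (r : LamTerm S V A) (t : LamTerm S W B) :
      LamTerm S (V ∪ W) (.and A B)
  | fst {V : Set S.TVar} {A B : S.LType} (t : LamTerm S V (.and A B)) : LamTerm S V A
  | snd {V : Set S.TVar} {A B : S.LType} (t : LamTerm S V (.and A B)) : LamTerm S V B
  | inl {V : Set S.TVar} {A : S.LType} (B : S.LType) (t : LamTerm S V A) :
      LamTerm S V (.or A B)
  | inr {V : Set S.TVar} {A : S.LType} (B : S.LType) (t : LamTerm S V A) :
      LamTerm S V (.or B A)
  | when {V W X : Set S.TVar} {A B C : S.LType} (r : LamTerm S V (.or A B))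
      (t : LamTerm S W (.imp A C)) (t' : LamTerm S X (.imp B C)) : LamTerm S (V ∪ W ∪ X) C
  | lam {V : Set S.TVar} {B : S.LType} (A : S.LType) (n : ℕ) (t : LamTerm S V B) :
      LamTerm S (V \ {(A, n)}) (.imp A B)
  | app {V W : Set S.TVar} {A B : S.LType} (r : LamTerm S V (.imp A B)) (t : LamTerm S W A) :
      LamTerm S (V ∪ W) B
  | star : LamTerm S ∅ .top
  | absurd (A : S.LType) : LamTerm S ∅ (.imp .bot A)
  | allI {V : Set S.TVar} {A : S.LType} (s : S.Srt) (x : ℕ) (t : LamTerm S V A)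
      (hx : ∀ y ∈ V, (s, x) ∉ y.1.FV) : LamTerm S V (LForm.all s x A)
  | allE {V : Set S.TVar} {A : S.LType} {s : S.Srt} {x : ℕ} (t : LamTerm S V (LForm.all s x A))
      (r : LTerm S.toLogicalSignature s) : LamTerm S V (LForm.subst x r A)
  | exI {V : Set S.TVar} {A : S.LType} {s : S.Srt} (x : ℕ) (r : LTerm S.toLogicalSignature s)
      (t : LamTerm S V (LForm.subst x r A)) : LamTerm S V (LForm.ex s x A)
  | exE {V W : Set S.TVar} {A B : S.LType} {s : S.Srt} {x : ℕ}
      (t : LamTerm S V (LForm.ex s x A)) (r : LamTerm S W (.imp A B))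
      (hx : ∀ y ∈ W, (s, x) ∉ y.1.FV) (hB : (s, x) ∉ B.FV) : LamTerm S (V ∪ W) B

/-- There is a term-in-context `x : B. t : A`. -/
def HasTermInContext (S : LambdaSignature.{u}) (B A : S.LType) : Prop :=
  ∃ (x : ℕ) (V : Set S.TVar) (_ : LamTerm S V A), V ⊆ {(B, x)}

/-- Logically distributive categories over `S`: a category with finite products, finite
coproducts and exponentials, together with a map `obj` from λ-types to objects, such that the
conditions below hold. That an object is *the* product, coproduct, exponential, etc. is
understood up to a given isomorphism. -/
structure LogicallyDistributive (S : LambdaSignature.{u}) (C : Type w) [Category.{v} C]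
    [CartesianMonoidalCategory C] [HasFiniteCoproducts C] [MonoidalClosed C] where
  /-- the canonical arrow `(X × Y) + (X × Z) ⟶ X × (Y + Z)` has an inverse -/
  distrib : ∀ X Y Z : C, IsIso (coprod.desc (X ◁ coprod.inl) (X ◁ coprod.inr) :
    (X ⊗ Y) ⨿ (X ⊗ Z) ⟶ X ⊗ (Y ⨿ Z))
  /-- the interpretation of λ-types -/
  obj : S.LType → C
  /-- `M 0` is the initial object -/
  zeroIso : obj .bot ≅ ⊥_ C
  /-- `M 1` is the terminal object -/
  oneIso : obj .top ≅ 𝟙_ C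
  /-- `M (A × B)` is the product of `M A` and `M B` -/
  prodIso : ∀ A B, obj (.and A B) ≅ obj A ⊗ obj B
  /-- `M (A + B)` is the coproduct of `M A` and `M B` -/
  sumIso : ∀ A B, obj (.or A B) ≅ obj A ⨿ obj B
  /-- `M (A → B)` is the exponential of `M B` by `M A` -/
  expIso : ∀ A B, obj (.imp A B) ≅ (ihom (obj A)).obj (obj B)
  /-- `M (∀ x : s. A)` is the vertex of a cone on the family `M (A[t/x])`, where `t` runs
  through the logical terms of sort `s` -/
  allProj : ∀ (s : S.Srt) (x : ℕ) (A : S.LType) (t : LTerm S.toLogicalSignature s),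
    obj (LForm.all s x A) ⟶ obj (LForm.subst x t A)
  /-- this cone is terminal among the cones with vertex `M B`, where `x : s` is not free
  in `B` -/
  all_terminal : ∀ (s : S.Srt) (x : ℕ) (A B : S.LType), (s, x) ∉ B.FV →
    ∀ f : ∀ t : LTerm S.toLogicalSignature s, obj B ⟶ obj (LForm.subst x t A),
      ∃! g : obj B ⟶ obj (LForm.all s x A), ∀ t, g ≫ allProj s x A t = f t
  /-- `M (∃ x : s. A)` is the vertex of a cocone on the family `M (A[t/x])`, where `t` runs
  through the logical terms of sort `s` -/
  exInj : ∀ (s : S.Srt) (x : ℕ) (A : S.LType) (t : LTerm S.toLogicalSignature s),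
    obj (LForm.subst x t A) ⟶ obj (LForm.ex s x A)
  /-- this cocone is initial among the cocones with vertex `M B`, where `x : s` is not free
  in `B` -/
  ex_initial : ∀ (s : S.Srt) (x : ℕ) (A B : S.LType), (s, x) ∉ B.FV →
    ∀ f : ∀ t : LTerm S.toLogicalSignature s, obj (LForm.subst x t A) ⟶ obj B,
      ∃! g : obj (LForm.ex s x A) ⟶ obj B, ∀ t, exInj s x A t ≫ g = f t
  /-- if `x : s` is not free in `A`, then the canonical arrow
  `M (∃ x : s. A × B) ⟶ M A × M (∃ x : s. B)`, whose component at the term `t` is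
  `1 × (injection at t) : M ((A × B)[t/x]) = M A × M (B[t/x]) ⟶ M A × M (∃ x : s. B)`,
  has an inverse -/
  ex_distrib : ∀ (s : S.Srt) (x : ℕ) (A B : S.LType) (hA : (s, x) ∉ A.FV)
    (h : obj (LForm.ex s x (.and A B)) ⟶ obj A ⊗ obj (LForm.ex s x B)),
    (∀ t : LTerm S.toLogicalSignature s, exInj s x (.and A B) t ≫ h =
      (prodIso (LForm.subst x t A) (LForm.subst x t B)).hom ≫
        (eqToHom (congrArg obj (LForm.subst_eq_self t hA)) ⊗ₘ exInj s x B t)) → IsIso h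

/-- A Σ-structure (model): a logically distributive category together with an arrow
`M A ⟶ M B` for each axiom symbol `a : A → B`. -/
structure SigmaStructure (S : LambdaSignature.{u}) (C : Type w) [Category.{v} C]
    [CartesianMonoidalCategory C] [HasFiniteCoproducts C] [MonoidalClosed C] extends
    LogicallyDistributive S C where
  /-- the interpretation of axiom symbols -/
  axHom : ∀ a : S.Ax, obj (S.axDom a) ⟶ obj (S.axCod a)

/-- `A` is a logical consequence of `B₁, …, Bₙ`: in every model `N` in every logically
distributive category there is an arrow `N (B₁ × ⋯ × Bₙ) ⟶ N A`. The universes of objects and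
arrows are arbitrary, except that the objects live at least in the universe of the
signature. -/
def LogicalConsequence (S : LambdaSignature.{u}) (Bs : List S.LType) (A : S.LType) : Prop :=
  ∀ (C : Type (max u w)) [Category.{v} C] [CartesianMonoidalCategory C] [HasFiniteCoproducts C]
    [MonoidalClosed C] (N : SigmaStructure S C),
    Nonempty (N.obj (LForm.prod Bs) ⟶ N.obj A)

end FirstOrderLD

/-! Only the existence of arrows matters, never equations between them, so the theorem compares
three notions of derivability.

Soundness (`LamTerm.entails_sub`) is an induction on λ-terms, strengthened to all simultaneous
substitutions `σ`: if `D` has an arrow to `Cσ` for the type `C` of each free typed variable of `t :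
A`, then `D` has an arrow to `Aσ`. The quantifiers force this generality. An arrow into `∀ x. A` is
obtained from arrows into all instances `A[r/x]`, and these are the induction hypothesis at `σ`
changed at `x` to `r`. Case analysis and ∃-elimination in a context `D` are reduced to the empty
context by moving `D` into the codomain as an exponential.

Completeness uses the syntactic model `TermCat.model`: λ-types preordered by inhabitation of `A →
B`. It is a thin category, so all equations hold automatically and each universal property reduces
to a derivation. A cone over the instances `A[t/x]` factors through `∀ x. A` because its component
at `t = x` can be generalised over `x`. An arrow of this model is by definition witnessed by a
closed λ-term.

For the second equivalence, proofs become λ-terms by `Proves.inhab`, and λ-terms become proofs by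
`LamTerm.proves_sub`, where a substitution again accompanies the induction, this time to rename
eigenvariables. -/

namespace FirstOrderLD

/-! ### Simultaneous substitution, freshness and renaming of quantified variables -/

section Substitution

variable {L : LogicalSignature.{u}}

lemma Term.bind_bind {Γ Δ Θ : List L.Srt} (φ : ∀ s, ℕ → Term L Δ s)
    (β : ∀ s, BVar Γ s → Term L Δ s) (φ' : ∀ s, ℕ → Term L Θ s)
    (β' : ∀ s, BVar Δ s → Term L Θ s) : ∀ {s : L.Srt} (t : Term L Γ s),
    (t.bind φ β).bind φ' β' =
      t.bind (fun s n => (φ s n).bind φ' β') (fun s i => (β s i).bind φ' β')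
  | _, .fvar _ => rfl
  | _, .bvar _ => rfl
  | _, .app f ts => by
      simp only [Term.bind]
      congr 1
      funext i
      exact Term.bind_bind φ β φ' β' (ts i)

lemma Term.weaken_bind_lift {Γ Δ : List L.Srt} (φ : ∀ s, ℕ → Term L Δ s)
    (β : ∀ s, BVar Γ s → Term L Δ s) (s' : L.Srt) {s : L.Srt} (t : Term L Γ s) :
    (t.weaken s').bind (fun r n => (φ r n).weaken s') (liftBound β s') =
      (t.bind φ β).weaken s' := by
  simp only [Term.weaken, Term.bind_bind]
  rfl

lemma liftBound_bind {Γ Δ Θ : List L.Srt} (β : ∀ s, BVar Γ s → Term L Δ s)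
    (φ' : ∀ s, ℕ → Term L Θ s) (β' : ∀ s, BVar Δ s → Term L Θ s) (s' : L.Srt) :
    (fun s i => (liftBound β s' s i).bind (fun r n => (φ' r n).weaken s') (liftBound β' s')) =
      liftBound (fun s i => (β s i).bind φ' β') s' := by
  funext s i
  cases i with
  | here => rfl
  | there i => exact Term.weaken_bind_lift φ' β' s' (β s i)

/-- Below a quantifier this needs that lifting commutes with composition: `Term.weaken_bind_lift`
for the free variables, `liftBound_bind` for the bound ones. -/
lemma Formula.bind_bind : ∀ {Γ Δ Θ : List L.Srt} (φ : ∀ s, ℕ → Term L Δ s)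
    (β : ∀ s, BVar Γ s → Term L Δ s) (φ' : ∀ s, ℕ → Term L Θ s)
    (β' : ∀ s, BVar Δ s → Term L Θ s) (A : Formula L Γ),
    (A.bind φ β).bind φ' β' =
      A.bind (fun s n => (φ s n).bind φ' β') (fun s i => (β s i).bind φ' β')
  | _, _, _, _, _, _, _, .bot => rfl
  | _, _, _, _, _, _, _, .top => rfl
  | _, _, _, φ, β, φ', β', .rel r ts => by
      simp only [Formula.bind, Term.bind_bind]
  | _, _, _, φ, β, φ', β', .and A B => by
      simp only [Formula.bind, Formula.bind_bind φ β φ' β' A, Formula.bind_bind φ β φ' β' B]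
  | _, _, _, φ, β, φ', β', .or A B => by
      simp only [Formula.bind, Formula.bind_bind φ β φ' β' A, Formula.bind_bind φ β φ' β' B]
  | _, _, _, φ, β, φ', β', .imp A B => by
      simp only [Formula.bind, Formula.bind_bind φ β φ' β' A, Formula.bind_bind φ β φ' β' B]
  | _, _, _, φ, β, φ', β', .all s A => by
      simp only [Formula.bind, Formula.bind_bind _ _ _ _ A, liftBound_bind,
        Term.weaken_bind_lift]
  | _, _, _, φ, β, φ', β', .ex s A => by
      simp only [Formula.bind, Formula.bind_bind _ _ _ _ A, liftBound_bind,
        Term.weaken_bind_lift]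

lemma Term.bind_congr {Γ Δ : List L.Srt} {φ φ' : ∀ s, ℕ → Term L Δ s}
    {β : ∀ s, BVar Γ s → Term L Δ s} : ∀ {s : L.Srt} (t : Term L Γ s),
    (∀ v ∈ t.FV, φ v.1 v.2 = φ' v.1 v.2) → t.bind φ β = t.bind φ' β
  | s, .fvar n, h => h (s, n) rfl
  | _, .bvar _, _ => rfl
  | _, .app f ts, h => by
      simp only [Term.bind]
      congr 1
      funext i
      exact Term.bind_congr (ts i) fun v hv => h v (Set.mem_iUnion.2 ⟨i, hv⟩)

lemma Formula.bind_congr : ∀ {Γ Δ : List L.Srt} {φ φ' : ∀ s, ℕ → Term L Δ s}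
    {β : ∀ s, BVar Γ s → Term L Δ s} (A : Formula L Γ),
    (∀ v ∈ A.FV, φ v.1 v.2 = φ' v.1 v.2) → A.bind φ β = A.bind φ' β
  | _, _, _, _, _, .bot, _ => rfl
  | _, _, _, _, _, .top, _ => rfl
  | _, _, _, _, _, .rel r ts, h => by
      simp only [Formula.bind]
      congr 1
      funext i
      exact Term.bind_congr (ts i) fun v hv => h v (Set.mem_iUnion.2 ⟨i, hv⟩)
  | _, _, _, _, _, .and A B, h => by
      simp only [Formula.bind]
      rw [Formula.bind_congr A fun v hv => h v (Or.inl hv),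
        Formula.bind_congr B fun v hv => h v (Or.inr hv)]
  | _, _, _, _, _, .or A B, h => by
      simp only [Formula.bind]
      rw [Formula.bind_congr A fun v hv => h v (Or.inl hv),
        Formula.bind_congr B fun v hv => h v (Or.inr hv)]
  | _, _, _, _, _, .imp A B, h => by
      simp only [Formula.bind]
      rw [Formula.bind_congr A fun v hv => h v (Or.inl hv),
        Formula.bind_congr B fun v hv => h v (Or.inr hv)]
  | _, _, _, _, _, .all s A, h => by
      simp only [Formula.bind]
      exact congrArg _ (Formula.bind_congr A fun v hv => congrArg (Term.weaken s) (h v hv))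
  | _, _, _, _, _, .ex s A, h => by
      simp only [Formula.bind]
      exact congrArg _ (Formula.bind_congr A fun v hv => congrArg (Term.weaken s) (h v hv))

lemma Term.finite_FV {Γ : List L.Srt} : ∀ {s : L.Srt} (t : Term L Γ s), t.FV.Finite
  | _, .fvar _ => Set.finite_singleton _
  | _, .bvar _ => Set.finite_empty
  | _, .app _ ts => Set.finite_iUnion fun i => Term.finite_FV (ts i)

lemma Formula.finite_FV : ∀ {Γ : List L.Srt} (A : Formula L Γ), A.FV.Finite
  | _, .bot => Set.finite_empty
  | _, .top => Set.finite_empty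
  | _, .rel _ ts => Set.finite_iUnion fun i => (ts i).finite_FV
  | _, .and A B => A.finite_FV.union B.finite_FV
  | _, .or A B => A.finite_FV.union B.finite_FV
  | _, .imp A B => A.finite_FV.union B.finite_FV
  | _, .all _ A => A.finite_FV
  | _, .ex _ A => A.finite_FV

lemma Term.not_mem_FV_bind {Γ Δ : List L.Srt} {φ : ∀ s, ℕ → Term L Δ s}
    {β : ∀ s, BVar Γ s → Term L Δ s} {w : LVar L} (hβ : ∀ s i, w ∉ (β s i).FV) :
    ∀ {s : L.Srt} (t : Term L Γ s), (∀ v ∈ t.FV, w ∉ (φ v.1 v.2).FV) → w ∉ (t.bind φ β).FV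
  | s, .fvar n, h => h (s, n) rfl
  | s, .bvar i, _ => hβ s i
  | _, .app f ts, h => fun hw => by
      obtain ⟨i, hi⟩ := Set.mem_iUnion.1 hw
      exact Term.not_mem_FV_bind hβ (ts i) (fun v hv => h v (Set.mem_iUnion.2 ⟨i, hv⟩)) hi

lemma Term.not_mem_FV_weaken {Γ : List L.Srt} {s s' : L.Srt} {t : Term L Γ s} {w : LVar L}
    (h : w ∉ t.FV) : w ∉ (t.weaken s').FV :=
  Term.not_mem_FV_bind (β := fun _ i => .bvar i.there) (fun _ _ => Set.notMem_empty _) t fun _ hv hw => h (hw ▸ hv)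

lemma not_mem_FV_liftBound {Γ Δ : List L.Srt} {β : ∀ s, BVar Γ s → Term L Δ s} {w : LVar L}
    (hβ : ∀ s i, w ∉ (β s i).FV) (s' : L.Srt) : ∀ s i, w ∉ (liftBound β s' s i).FV
  | _, .here => fun hw => hw
  | s, .there i => Term.not_mem_FV_weaken (hβ s i)

lemma Formula.not_mem_FV_bind : ∀ {Γ Δ : List L.Srt} {φ : ∀ s, ℕ → Term L Δ s}
    {β : ∀ s, BVar Γ s → Term L Δ s} {w : LVar L} (_ : ∀ s i, w ∉ (β s i).FV)
    (A : Formula L Γ), (∀ v ∈ A.FV, w ∉ (φ v.1 v.2).FV) → w ∉ (A.bind φ β).FV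
  | _, _, _, _, _, _, .bot, _ => fun hw => hw
  | _, _, _, _, _, _, .top, _ => fun hw => hw
  | _, _, _, _, _, hβ, .rel r ts, h => fun hw => by
      obtain ⟨i, hi⟩ := Set.mem_iUnion.1 hw
      exact Term.not_mem_FV_bind hβ (ts i) (fun v hv => h v (Set.mem_iUnion.2 ⟨i, hv⟩)) hi
  | _, _, _, _, _, hβ, .and A B, h => fun hw =>
      hw.elim (Formula.not_mem_FV_bind hβ A fun v hv => h v (.inl hv))
        (Formula.not_mem_FV_bind hβ B fun v hv => h v (.inr hv))
  | _, _, _, _, _, hβ, .or A B, h => fun hw =>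
      hw.elim (Formula.not_mem_FV_bind hβ A fun v hv => h v (.inl hv))
        (Formula.not_mem_FV_bind hβ B fun v hv => h v (.inr hv))
  | _, _, _, _, _, hβ, .imp A B, h => fun hw =>
      hw.elim (Formula.not_mem_FV_bind hβ A fun v hv => h v (.inl hv))
        (Formula.not_mem_FV_bind hβ B fun v hv => h v (.inr hv))
  | _, _, _, _, _, hβ, .all s A, h =>
      Formula.not_mem_FV_bind (not_mem_FV_liftBound hβ s) A
        fun v hv => Term.not_mem_FV_weaken (h v hv)
  | _, _, _, _, _, hβ, .ex s A, h =>
      Formula.not_mem_FV_bind (not_mem_FV_liftBound hβ s) A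
        fun v hv => Term.not_mem_FV_weaken (h v hv)

/-- Simultaneous substitution for the free variables of a formula. -/
def LForm.sub (σ : ∀ s, ℕ → LTerm L s) (A : LForm L) : LForm L :=
  A.bind σ (fun _ i => .bvar i)

/-- Simultaneous substitution for the free variables of a term. -/
def LTerm.sub (σ : ∀ s, ℕ → LTerm L s) {s : L.Srt} (t : LTerm L s) : LTerm L s :=
  t.bind σ (fun _ i => .bvar i)

open Classical in
/-- The assignment `σ`, changed at the variable `x : s` to the value `t`. -/
noncomputable def update {Γ : List L.Srt} (σ : ∀ s, ℕ → Term L Γ s) {s : L.Srt} (x : ℕ)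
    (t : Term L Γ s) : ∀ s', ℕ → Term L Γ s' :=
  fun s' y => if h : s = s' ∧ x = y then h.1 ▸ t else σ s' y

lemma update_same {Γ : List L.Srt} (σ : ∀ s, ℕ → Term L Γ s) {s : L.Srt} (x : ℕ)
    (t : Term L Γ s) : update σ x t s x = t :=
  dif_pos ⟨rfl, rfl⟩

lemma update_of_ne {Γ : List L.Srt} (σ : ∀ s, ℕ → Term L Γ s) {s : L.Srt} {x : ℕ}
    (t : Term L Γ s) {v : LVar L} (h : v ≠ (s, x)) : update σ x t v.1 v.2 = σ v.1 v.2 :=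
  dif_neg fun h' => h (Prod.ext h'.1.symm h'.2.symm)

lemma single_eq_update {Γ : List L.Srt} {s : L.Srt} (x : ℕ) (t : Term L Γ s) :
    single x t = update (fun _ n => .fvar n) x t := rfl

lemma LForm.sub_fvar (A : LForm L) : A.sub (fun _ n => .fvar n) = A :=
  Formula.bind_eq_self A fun _ _ => rfl

lemma LForm.sub_of_closed {A : LForm L} (h : A.FV = ∅) (σ : ∀ s, ℕ → LTerm L s) :
    A.sub σ = A :=
  Formula.bind_eq_self A fun v hv => by simp [h] at hv

lemma LForm.sub_update_of_not_mem {A : LForm L} (σ : ∀ s, ℕ → LTerm L s) {s : L.Srt} {x : ℕ}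
    (t : LTerm L s) (h : (s, x) ∉ A.FV) : A.sub (update σ x t) = A.sub σ :=
  Formula.bind_congr A fun v hv => update_of_ne σ t (by rintro rfl; exact h hv)

lemma LForm.sub_subst (σ : ∀ s, ℕ → LTerm L s) {s : L.Srt} (x : ℕ) (r : LTerm L s)
    (A : LForm L) : (LForm.subst x r A).sub σ = A.sub (update σ x (r.sub σ)) := by
  unfold LForm.subst LForm.sub
  rw [Formula.bind_bind]
  refine Formula.bind_congr A fun v _ => ?_
  rw [single_eq_update]
  by_cases h : v = (s, x)
  · subst h
    simp only [update_same]
    rfl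
  · rw [update_of_ne _ _ h, update_of_ne _ _ h]
    rfl

/-- The variable `y : s` does not occur in the values of `σ` at the free variables of
`∀ x : s. A`. -/
def Fresh (σ : ∀ s, ℕ → LTerm L s) (s : L.Srt) (x y : ℕ) (A : LForm L) : Prop :=
  ∀ v ∈ A.FV, v ≠ (s, x) → (s, y) ∉ (σ v.1 v.2).FV

lemma exists_not_mem_of_finite (s : L.Srt) {X : Set (LVar L)} (hX : X.Finite) :
    ∃ y : ℕ, (s, y) ∉ X := by
  obtain ⟨y, hy⟩ := (hX.image Prod.snd).exists_notMem
  exact ⟨y, fun h => hy ⟨_, h, rfl⟩⟩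

lemma exists_fresh (σ : ∀ s, ℕ → LTerm L s) (s : L.Srt) (x : ℕ) (A : LForm L)
    {X : Set (LVar L)} (hX : X.Finite) : ∃ y : ℕ, Fresh σ s x y A ∧ (s, y) ∉ X := by
  obtain ⟨y, hy⟩ := exists_not_mem_of_finite s
    ((A.finite_FV.biUnion fun v _ => (σ v.1 v.2).finite_FV).union hX)
  exact ⟨y, fun v hv _ h => hy (Or.inl (Set.mem_biUnion hv h)), fun h => hy (Or.inr h)⟩

/-- Binding `y` after substituting affects only the `y` put in place of `x`: by freshness, `y`
occurs in no other substituted value, so those values are merely weakened. This is the common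
content of `LForm.all_sub` and `LForm.ex_sub`, which carry `σ` through a quantifier at the price of
renaming `x` to `y`. -/
lemma close_sub {σ : ∀ s, ℕ → LTerm L s} {s : L.Srt} {x y : ℕ} {A : LForm L}
    (h : Fresh σ s x y A) :
    (A.close s x).bind (fun s' n => (σ s' n).weaken s) (liftBound (fun _ i => .bvar i) s) =
      (A.sub (update σ x (.fvar y : LTerm L s))).close s y := by
  unfold LForm.close LForm.sub
  rw [Formula.bind_bind, Formula.bind_bind]
  refine Formula.bind_congr A fun v hv => ?_
  rw [single_eq_update, single_eq_update]
  by_cases hx : v = (s, x)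
  · subst hx
    rw [update_same, update_same]
    exact (update_same _ y _).symm
  · rw [update_of_ne _ _ hx, update_of_ne _ _ hx]
    refine (Term.bind_congr (φ := update _ y _) (φ' := fun _ n => .fvar n) (σ v.1 v.2)
      fun z hz => ?_).symm
    exact update_of_ne _ _ (by rintro rfl; exact h v hv hx hz)

lemma LForm.all_sub {σ : ∀ s, ℕ → LTerm L s} {s : L.Srt} {x y : ℕ} {A : LForm L}
    (h : Fresh σ s x y A) :
    (LForm.all s x A).sub σ = LForm.all s y (A.sub (update σ x (.fvar y : LTerm L s))) :=
  congrArg (Formula.all s) (close_sub h)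

lemma LForm.ex_sub {σ : ∀ s, ℕ → LTerm L s} {s : L.Srt} {x y : ℕ} {A : LForm L}
    (h : Fresh σ s x y A) :
    (LForm.ex s x A).sub σ = LForm.ex s y (A.sub (update σ x (.fvar y : LTerm L s))) :=
  congrArg (Formula.ex s) (close_sub h)

/-- The instances of the renamed matrix are those of the original one, so the renaming disappears
once the quantifier is instantiated. -/
lemma LForm.subst_sub_update {σ : ∀ s, ℕ → LTerm L s} {s : L.Srt} {x y : ℕ} {A : LForm L}
    (h : Fresh σ s x y A) (t : LTerm L s) :
    LForm.subst y t (A.sub (update σ x (.fvar y : LTerm L s))) = A.sub (update σ x t) := by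
  unfold LForm.subst LForm.sub
  rw [Formula.bind_bind]
  refine Formula.bind_congr A fun v hv => ?_
  rw [single_eq_update]
  by_cases hx : v = (s, x)
  · subst hx
    rw [update_same, update_same]
    exact update_same _ y _
  · rw [update_of_ne _ _ hx, update_of_ne _ _ hx]
    exact Term.bind_eq_self _ fun z hz =>
      update_of_ne _ _ (by rintro rfl; exact h v hv hx hz)

/-- Allows the variable `x` itself to be used as a generic instance or witness. -/
lemma LForm.subst_fvar_self {s : L.Srt} (x : ℕ) (A : LForm L) :
    LForm.subst x (.fvar x : LTerm L s) A = A := by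
  refine Formula.bind_eq_self A fun v _ => ?_
  rw [single_eq_update]
  by_cases hx : v = (s, x)
  · subst hx
    rw [update_same]
  · rw [update_of_ne _ _ hx]

lemma LForm.not_mem_FV_ex (s : L.Srt) (x : ℕ) (A : LForm L) :
    (s, x) ∉ (LForm.ex s x A).FV := by
  refine Formula.not_mem_FV_bind (β := fun _ i => .bvar i.there) (fun _ _ => Set.notMem_empty _) A
    fun v _ => ?_
  rw [single_eq_update]
  by_cases hx : v = (s, x)
  · subst hx
    rw [update_same]
    exact fun hw => hw
  · rw [update_of_ne _ _ hx]
    exact fun hw => hx hw.symm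

end Substitution

/-! ### Inhabited λ-types and their equivalence with natural deduction -/

section Derivability

variable {S : LambdaSignature.{u}}

/-- There is a λ-term of type `A` whose free typed variables belong to `P`. -/
def Inhab (S : LambdaSignature.{u}) (P : Set S.TVar) (A : S.LType) : Prop :=
  ∃ (V : Set S.TVar) (_ : LamTerm S V A), V ⊆ P

namespace Inhab

variable {P Q : Set S.TVar} {A B C : S.LType}

/-- The index `V` of `LamTerm` is the exact set of free variables; bounding it from above instead is
what makes weakening available. -/
lemma mono (h : Inhab S P A) (hPQ : P ⊆ Q) : Inhab S Q A :=
  let ⟨V, t, hV⟩ := h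
  ⟨V, t, hV.trans hPQ⟩

lemma var {n : ℕ} (h : (A, n) ∈ P) : Inhab S P A :=
  ⟨_, .var A n, Set.singleton_subset_iff.2 h⟩

lemma and_intro (h : Inhab S P A) (k : Inhab S P B) : Inhab S P (.and A B) :=
  let ⟨_, t, hV⟩ := h
  let ⟨_, r, hW⟩ := k
  ⟨_, .pair t r, Set.union_subset hV hW⟩

lemma and_left (h : Inhab S P (.and A B)) : Inhab S P A :=
  let ⟨_, t, hV⟩ := h
  ⟨_, .fst t, hV⟩

lemma and_right (h : Inhab S P (.and A B)) : Inhab S P B :=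
  let ⟨_, t, hV⟩ := h
  ⟨_, .snd t, hV⟩

lemma or_left (h : Inhab S P A) : Inhab S P (.or A B) :=
  let ⟨_, t, hV⟩ := h
  ⟨_, .inl B t, hV⟩

lemma or_right (h : Inhab S P B) : Inhab S P (.or A B) :=
  let ⟨_, t, hV⟩ := h
  ⟨_, .inr A t, hV⟩

lemma or_elim (h : Inhab S P (.or A B)) (k : Inhab S P (.imp A C))
    (l : Inhab S P (.imp B C)) : Inhab S P C :=
  let ⟨_, t, hV⟩ := h
  let ⟨_, r, hW⟩ := k
  let ⟨_, r', hX⟩ := l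
  ⟨_, .when t r r', Set.union_subset (Set.union_subset hV hW) hX⟩

lemma imp_intro (n : ℕ) (h : Inhab S (insert (A, n) P) B) : Inhab S P (.imp A B) :=
  let ⟨_, t, hV⟩ := h
  ⟨_, .lam A n t, Set.sdiff_singleton_subset_iff.2 hV⟩

lemma imp_elim (h : Inhab S P (.imp A B)) (k : Inhab S P A) : Inhab S P B :=
  let ⟨_, t, hV⟩ := h
  let ⟨_, r, hW⟩ := k
  ⟨_, .app t r, Set.union_subset hV hW⟩

lemma top : Inhab S P .top := ⟨_, .star, Set.empty_subset _⟩

lemma bot_imp : Inhab S P (.imp .bot A) := ⟨_, .absurd A, Set.empty_subset _⟩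

lemma axiom_imp (a : S.Ax) : Inhab S P (.imp (S.axDom a) (S.axCod a)) :=
  imp_intro 0 ⟨_, .ax a (.var _ 0), by simp⟩

lemma all_intro {s : S.Srt} {x : ℕ} (hx : ∀ y ∈ P, (s, x) ∉ y.1.FV) (h : Inhab S P A) :
    Inhab S P (LForm.all s x A) :=
  let ⟨_, t, hV⟩ := h
  ⟨_, .allI s x t fun y hy => hx y (hV hy), hV⟩

lemma all_elim {s : S.Srt} {x : ℕ} (h : Inhab S P (LForm.all s x A))
    (r : LTerm S.toLogicalSignature s) : Inhab S P (LForm.subst x r A) :=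
  let ⟨_, t, hV⟩ := h
  ⟨_, .allE t r, hV⟩

lemma ex_intro {s : S.Srt} {x : ℕ} (r : LTerm S.toLogicalSignature s)
    (h : Inhab S P (LForm.subst x r A)) : Inhab S P (LForm.ex s x A) :=
  let ⟨_, t, hV⟩ := h
  ⟨_, .exI x r t, hV⟩

/-- Two bounds `P` and `Q` are kept apart because the eigenvariable condition concerns only the term
of type `A → B`, not the one of type `∃ x. A`. -/
lemma ex_elim {s : S.Srt} {x : ℕ} (hx : ∀ y ∈ Q, (s, x) ∉ y.1.FV) (hB : (s, x) ∉ B.FV)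
    (h : Inhab S P (LForm.ex s x A)) (k : Inhab S Q (.imp A B)) : Inhab S (P ∪ Q) B :=
  let ⟨_, t, hV⟩ := h
  let ⟨_, r, hW⟩ := k
  ⟨_, .exE t r (fun y hy => hx y (hW hy)) hB, Set.union_subset_union hV hW⟩

lemma of_empty (h : Inhab S ∅ A) : Inhab S P A := h.mono (Set.empty_subset _)

lemma hyp {n : ℕ} : Inhab S (insert (A, n) P) A := var (Set.mem_insert _ _)

lemma imp_refl : Inhab S P (.imp A A) := imp_intro 0 hyp

lemma imp_trans (h : Inhab S ∅ (.imp A B)) (k : Inhab S ∅ (.imp B C)) :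
    Inhab S ∅ (.imp A C) :=
  imp_intro 0 (k.of_empty.imp_elim (h.of_empty.imp_elim hyp))

end Inhab

lemma hasTermInContext_iff {B A : S.LType} :
    HasTermInContext S B A ↔ Inhab S ∅ (.imp B A) := by
  constructor
  · rintro ⟨x, V, t, hV⟩
    exact Inhab.imp_intro x ⟨V, t, by simpa using hV⟩
  · intro h
    obtain ⟨V, t, hV⟩ := (h.of_empty (P := {(B, 0)})).imp_elim (Inhab.var rfl)
    exact ⟨0, V, t, hV⟩

/-- The typed variables named `0` whose types belong to `Γ`. -/
def zeroVars (Γ : Multiset S.LType) : Set S.TVar := {y | y.1 ∈ Γ ∧ y.2 = 0}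

lemma zeroVars_cons (A : S.LType) (Γ : Multiset S.LType) :
    zeroVars (A ::ₘ Γ) ⊆ insert (A, 0) (zeroVars Γ) := by
  rintro ⟨B, n⟩ ⟨hB, hn⟩
  rcases Multiset.mem_cons.1 hB with h | h
  · exact Or.inl (Prod.ext h hn)
  · exact Or.inr ⟨h, hn⟩

/-- Only inhabitation counts, so equal assumptions may share one typed variable, and a single name
suffices for every type. -/
lemma Proves.inhab {Γ : Multiset S.LType} {A : S.LType} (h : Proves S Γ A) :
    Inhab S (zeroVars Γ) A := by
  induction h with
  | assumption h => exact .var (n := 0) ⟨h, rfl⟩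
  | ax a => exact .axiom_imp a
  | andI _ _ ih ih' => exact ih.and_intro ih'
  | andE_left _ ih => exact ih.and_left
  | andE_right _ ih => exact ih.and_right
  | orI_left _ ih => exact ih.or_left
  | orI_right _ ih => exact ih.or_right
  | orE _ _ _ ih ih' ih'' => exact ih.or_elim ih' ih''
  | impI _ ih => exact .imp_intro 0 (ih.mono (zeroVars_cons _ _))
  | impE _ _ ih ih' => exact ih.imp_elim ih'
  | topI => exact .top
  | botE => exact .bot_imp
  | allI hx _ ih => exact .all_intro (fun y hy => hx _ hy.1) ih
  | allE t _ ih => exact ih.all_elim t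
  | exI t _ ih => exact ih.ex_intro t
  | exE hx hA _ _ ih ih' => exact (Inhab.ex_elim (fun y hy => hx _ hy.1) hA ih ih').mono (Set.union_self _).subset

/-- The assumptions are discharged one at a time by abstraction, and the resulting function is
applied to the given inhabitant. It serves to replace separate assumptions by projections from their
product. -/
lemma Inhab.cut {Q : Set S.TVar} : ∀ (Bs : List S.LType) {A : S.LType},
    (∀ B ∈ Bs, Inhab S Q B) → Inhab S (zeroVars (Bs : Multiset S.LType)) A → Inhab S Q A
  | [], _, _, h => h.mono fun y hy => absurd hy.1 (by simp)
  | B :: Bs, _, hB, h =>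
      (Inhab.cut Bs (fun C hC => hB C (List.mem_cons_of_mem _ hC))
        (.imp_intro 0 (h.mono (zeroVars_cons B Bs)))).imp_elim (hB B List.mem_cons_self)

lemma Inhab.of_prod {Q : Set S.TVar} : ∀ {Bs : List S.LType},
    Inhab S Q (LForm.prod Bs) → ∀ B ∈ Bs, Inhab S Q B
  | [], _, B, hB => by simp at hB
  | [_], h, B, hB => by
      obtain rfl := List.mem_singleton.1 hB
      exact h
  | _ :: _ :: _, h, B, hB => by
      rcases List.mem_cons.1 hB with rfl | hB
      · exact Inhab.and_left h
      · exact Inhab.of_prod (Inhab.and_right h) B hB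

lemma Proves.prod {Γ : Multiset S.LType} : ∀ {Bs : List S.LType},
    (∀ B ∈ Bs, Proves S Γ B) → Proves S Γ (LForm.prod Bs)
  | [], _ => .topI
  | [_], h => h _ List.mem_cons_self
  | _ :: _ :: _, h => .andI (h _ List.mem_cons_self)
      (Proves.prod fun C hC => h C (List.mem_cons_of_mem _ hC))

lemma finite_FV_multiset (Γ : Multiset S.LType) : {v | ∃ C ∈ Γ, v ∈ C.FV}.Finite := by
  classical
  refine ((Γ.toFinset.finite_toSet).biUnion fun C _ => C.finite_FV).subset ?_
  rintro v ⟨C, hC, hv⟩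
  exact Set.mem_biUnion (by simpa using hC) hv

lemma axDom_sub (a : S.Ax) (σ : ∀ s, ℕ → LTerm S.toLogicalSignature s) :
    (S.axDom a).sub σ = S.axDom a :=
  LForm.sub_of_closed (Set.union_empty_iff.1 (S.ax_closed a)).1 σ

lemma axCod_sub (a : S.Ax) (σ : ∀ s, ℕ → LTerm S.toLogicalSignature s) :
    (S.axCod a).sub σ = S.axCod a :=
  LForm.sub_of_closed (Set.union_empty_iff.1 (S.ax_closed a)).2 σ

/-- The side conditions of a λ-term see only its free variables, whereas those of a proof see all of
`Γ`, including formulae introduced by vacuous abstractions. An eigenvariable of the term may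
therefore be free in `Γ` and has to be renamed; `σ` records these renamings. -/
lemma LamTerm.proves_sub {V : Set S.TVar} {A : S.LType} (t : LamTerm S V A) :
    ∀ (σ : ∀ s, ℕ → LTerm S.toLogicalSignature s) (Γ : Multiset S.LType),
      (∀ y ∈ V, y.1.sub σ ∈ Γ) → Proves S Γ (A.sub σ) := by
  induction t with
  | var A n => exact fun σ Γ h => .assumption (h _ rfl)
  | ax a t ih =>
    intro σ Γ h
    have := ih σ Γ h
    rw [axDom_sub] at this
    rw [axCod_sub]
    exact .impE (.ax a) this
  | pair r t ih ih' =>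
    exact fun σ Γ h => .andI (ih σ Γ fun y hy => h y (.inl hy)) (ih' σ Γ fun y hy => h y (.inr hy))
  | fst t ih => exact fun σ Γ h => .andE_left (ih σ Γ h)
  | snd t ih => exact fun σ Γ h => .andE_right (ih σ Γ h)
  | inl B t ih => exact fun σ Γ h => .orI_left (ih σ Γ h)
  | inr B t ih => exact fun σ Γ h => .orI_right (ih σ Γ h)
  | when r t t' ih ih' ih'' =>
    exact fun σ Γ h => .orE (ih σ Γ fun y hy => h y (.inl (.inl hy)))
      (ih' σ Γ fun y hy => h y (.inl (.inr hy))) (ih'' σ Γ fun y hy => h y (.inr hy))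
  | lam A n t ih =>
    refine fun σ Γ h => .impI (ih σ _ fun y hy => Multiset.mem_cons.2 ?_)
    by_cases hy' : y = (A, n)
    · exact .inl (by rw [hy']; rfl)
    · exact .inr (h y ⟨hy, hy'⟩)
  | app r t ih ih' =>
    exact fun σ Γ h => .impE (ih σ Γ fun y hy => h y (.inl hy)) (ih' σ Γ fun y hy => h y (.inr hy))
  | star => exact fun _ _ _ => .topI
  | absurd A => exact fun _ _ _ => .botE
  | @allI V A s x t hx ih =>
    intro σ Γ h
    -- `z` becomes the eigenvariable: finitely many names are excluded, so it can avoid `Γ` as well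
    -- as the values of `σ`.
    obtain ⟨z, hz, hzΓ⟩ := exists_fresh σ s x A (finite_FV_multiset Γ)
    rw [LForm.all_sub hz]
    refine .allI (fun C hC hzC => hzΓ ⟨C, hC, hzC⟩) (ih _ Γ fun y hy => ?_)
    rw [LForm.sub_update_of_not_mem _ _ (hx y hy)]
    exact h y hy
  | @allE V A s x t r ih =>
    intro σ Γ h
    obtain ⟨z, hz, -⟩ := exists_fresh σ s x A Set.finite_empty
    have := ih σ Γ h
    rw [LForm.all_sub hz] at this
    rw [LForm.sub_subst, ← LForm.subst_sub_update hz]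
    exact .allE _ this
  | @exI V A s x r t ih =>
    intro σ Γ h
    obtain ⟨z, hz, -⟩ := exists_fresh σ s x A Set.finite_empty
    have := ih σ Γ h
    rw [LForm.sub_subst, ← LForm.subst_sub_update hz] at this
    rw [LForm.ex_sub hz]
    exact .exI _ this
  | @exE V W A B s x t r hx hB ih ih' =>
    intro σ Γ h
    obtain ⟨z, hz, hzΓ⟩ := exists_fresh σ s x A
      ((finite_FV_multiset Γ).union (B.sub σ).finite_FV)
    have h1 := ih σ Γ fun y hy => h y (.inl hy)
    rw [LForm.ex_sub hz] at h1
    refine .exE (fun C hC hzC => hzΓ (.inl ⟨C, hC, hzC⟩)) (fun h => hzΓ (.inr h)) h1 ?_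
    -- Sending `x` to `z` changes neither the assumptions used by `r` nor `B`, as `x` is free in
    -- none of them.
    have h2 := ih' (update σ x (.fvar z : LTerm S.toLogicalSignature s)) Γ fun y hy => by
      rw [LForm.sub_update_of_not_mem _ _ (hx y hy)]
      exact h y (.inr hy)
    have e : LForm.sub (L := S.toLogicalSignature)
        (update σ x (.fvar z : LTerm S.toLogicalSignature s)) (.imp A B) =
        .imp (A.sub (update σ x (.fvar z : LTerm S.toLogicalSignature s)))
          (B.sub (update σ x (.fvar z : LTerm S.toLogicalSignature s))) := rfl
    rwa [e, LForm.sub_update_of_not_mem _ _ hB] at h2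

theorem hasTermInContext_prod_iff_proves {Bs : List S.LType} {A : S.LType} :
    HasTermInContext S (LForm.prod Bs) A ↔ Proves S (Bs : Multiset S.LType) A := by
  rw [hasTermInContext_iff]
  constructor
  · rintro ⟨V, t, hV⟩
    -- A closed term imposes no condition on `Γ`, so the assumptions `Bs` can be taken at once.
    have := t.proves_sub (fun _ n => .fvar n) (Bs : Multiset S.LType)
      fun y hy => absurd (hV hy) (Set.notMem_empty y)
    rw [LForm.sub_fvar] at this
    exact .impE this (.prod fun B hB => .assumption (by simpa using hB))
  · intro h
    exact .imp_intro 0 (.cut Bs (Inhab.of_prod .hyp) h.inhab)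

end Derivability

/-! ### Categorical structure on a preorder -/

section Thin

variable {C : Type w} [Category.{v} C] [Quiver.IsThin C]

/-- A thin category with binary meets and a greatest object is cartesian monoidal. -/
@[reducible] def thinCartesian (one : C) (toOne : ∀ X, X ⟶ one) (prod : C → C → C)
    (fst : ∀ X Y, prod X Y ⟶ X) (snd : ∀ X Y, prod X Y ⟶ Y)
    (lift : ∀ {T X Y : C}, (T ⟶ X) → (T ⟶ Y) → (T ⟶ prod X Y)) :
    CartesianMonoidalCategory C :=
  .ofChosenFiniteProducts
    ⟨asEmptyCone one, IsTerminal.ofUniqueHom toOne fun _ _ => Subsingleton.elim _ _⟩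
    fun X Y => ⟨BinaryFan.mk (fst X Y) (snd X Y), BinaryFan.isLimitMk
      (fun s => lift s.fst s.snd) (fun _ => Subsingleton.elim _ _)
      (fun _ => Subsingleton.elim _ _) (fun _ _ _ _ => Subsingleton.elim _ _)⟩

/-- A thin cartesian monoidal category with relative pseudocomplements is closed. -/
@[reducible] def thinClosed [CartesianMonoidalCategory C] (exp : C → C → C)
    (eval : ∀ X Y, X ⊗ exp X Y ⟶ Y) (curry : ∀ {X Y T : C}, (X ⊗ T ⟶ Y) → (T ⟶ exp X Y)) :
    MonoidalClosed C where
  closed X :=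
    { rightAdj :=
        { obj := exp X
          map := fun f => curry (eval X _ ≫ f)
          map_id := fun _ => Subsingleton.elim _ _
          map_comp := fun _ _ => Subsingleton.elim _ _ }
      adj := Adjunction.mkOfHomEquiv
        { homEquiv := fun _ Y =>
            { toFun := fun f => curry f
              invFun := fun g => X ◁ g ≫ eval X Y
              left_inv := fun _ => Subsingleton.elim _ _
              right_inv := fun _ => Subsingleton.elim _ _ }
          homEquiv_naturality_left_symm := fun _ _ => Subsingleton.elim _ _
          homEquiv_naturality_right := fun _ _ => Subsingleton.elim _ _ } }

lemma thin_hasFiniteCoproducts (zero : C) (ofZero : ∀ X, zero ⟶ X) (sum : C → C → C)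
    (inl : ∀ X Y, X ⟶ sum X Y) (inr : ∀ X Y, Y ⟶ sum X Y)
    (desc : ∀ {T X Y : C}, (X ⟶ T) → (Y ⟶ T) → (sum X Y ⟶ T)) : HasFiniteCoproducts C := by
  have : HasInitial C :=
    (IsInitial.ofUniqueHom ofZero fun _ _ => Subsingleton.elim _ _).hasInitial
  have : ∀ X Y : C, HasColimit (pair X Y) := fun X Y => ⟨⟨BinaryCofan.mk (inl X Y) (inr X Y),
    BinaryCofan.isColimitMk (fun s => desc s.inl s.inr) (fun _ => Subsingleton.elim _ _)
      (fun _ => Subsingleton.elim _ _) (fun _ _ _ _ => Subsingleton.elim _ _)⟩⟩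
  have := hasBinaryCoproducts_of_hasColimit_pair C
  exact hasFiniteCoproducts_of_has_binary_and_initial

/-- In a thin category, arrows in both directions form an isomorphism. -/
def thinIso {X Y : C} (f : X ⟶ Y) (g : Y ⟶ X) : X ≅ Y :=
  ⟨f, g, Subsingleton.elim _ _, Subsingleton.elim _ _⟩

lemma thin_isIso {X Y : C} (f : X ⟶ Y) (g : Y ⟶ X) : IsIso f :=
  (thinIso f g).isIso_hom

/-- Distributivity follows from closedness: the inverse arrow is built by copairing after currying
in `X`. -/
lemma thin_distrib [CartesianMonoidalCategory C] [HasFiniteCoproducts C] [MonoidalClosed C]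
    (X Y Z : C) : IsIso (coprod.desc (X ◁ coprod.inl) (X ◁ coprod.inr) :
      (X ⊗ Y) ⨿ (X ⊗ Z) ⟶ X ⊗ (Y ⨿ Z)) :=
  thin_isIso _ (MonoidalClosed.uncurry
    (coprod.desc (MonoidalClosed.curry coprod.inl) (MonoidalClosed.curry coprod.inr)))

end Thin

/-! ### The syntactic model, for completeness -/

section TermModel

/-- The λ-types over `S`, as objects of the category in which there is one arrow `A ⟶ B` if
there is a closed λ-term of type `A → B`, and none otherwise. -/
structure TermCat (S : LambdaSignature.{u}) : Type (max u w) where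
  /-- the object given by a λ-type in a larger universe -/
  up ::
  /-- the underlying λ-type -/
  down : ULift.{w} S.LType

namespace TermCat

variable {S : LambdaSignature.{u}}

/-- The object given by a λ-type. -/
def mk (A : S.LType) : TermCat.{u, w} S := ⟨⟨A⟩⟩

/-- The λ-type that an object stands for. -/
def ty (X : TermCat.{u, w} S) : S.LType := X.down.down

instance category : Category.{v} (TermCat.{u, w} S) where
  -- The lift places this proposition in an arbitrary universe of arrows, as required of the models
  -- in `LogicalConsequence`.
  Hom X Y := ULift.{v} (PLift (Inhab S ∅ (.imp X.ty Y.ty)))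
  id _ := ⟨⟨.imp_refl⟩⟩
  comp f g := ⟨⟨f.down.down.imp_trans g.down.down⟩⟩

instance isThin : @Quiver.IsThin (TermCat.{u, w} S) category.{u, v, w}.toQuiver :=
  fun _ _ => ⟨fun ⟨⟨_⟩⟩ ⟨⟨_⟩⟩ => rfl⟩

/-- The arrow given by a derivation. -/
def homMk {X Y : TermCat.{u, w} S} (h : Inhab S {(X.ty, 0)} Y.ty) :
    category.{u, v, w}.Hom X Y :=
  ⟨⟨.imp_intro 0 (by simpa using h)⟩⟩

lemma inhab_of_hom {X Y : TermCat.{u, w} S} (f : category.{u, v, w}.Hom X Y) {P : Set S.TVar}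
    (h : Inhab S P X.ty) : Inhab S P Y.ty :=
  f.down.down.of_empty.imp_elim h

lemma inhab_self (A : S.LType) : Inhab S {(A, 0)} A := .var rfl

instance cartesian : @CartesianMonoidalCategory (TermCat.{u, w} S) category.{u, v, w} :=
  thinCartesian (mk .top) (fun _ => homMk .top) (fun X Y => mk (.and X.ty Y.ty))
    (fun _ _ => homMk (inhab_self _).and_left) (fun _ _ => homMk (inhab_self _).and_right)
    (fun f g => homMk ((inhab_of_hom f (inhab_self _)).and_intro
      (inhab_of_hom g (inhab_self _))))

instance hasFiniteCoproducts : @HasFiniteCoproducts (TermCat.{u, w} S) category.{u, v, w} :=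
  thin_hasFiniteCoproducts (mk .bot) (fun _ => homMk (Inhab.bot_imp.imp_elim (inhab_self _)))
    (fun X Y => mk (.or X.ty Y.ty)) (fun _ _ => homMk (inhab_self _).or_left)
    (fun _ _ => homMk (inhab_self _).or_right)
    (fun f g => homMk ((inhab_self _).or_elim f.down.down.of_empty g.down.down.of_empty))

instance closed : @MonoidalClosed (TermCat.{u, w} S) category.{u, v, w}
    cartesian.{u, v, w}.toMonoidalCategory :=
  thinClosed (fun X Y => mk (.imp X.ty Y.ty))
    (fun _ _ => homMk ((inhab_self _).and_right.imp_elim (inhab_self _).and_left))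
    (fun f => homMk (.imp_intro 0 (inhab_of_hom f
      (.and_intro .hyp ((inhab_self _).mono (Set.subset_insert _ _))))))

/-- Of the whole family only the component at the variable `x` is used; `x` is not free in `B`, so
the result may be generalised over `x`. -/
lemma exists_all_lift {s : S.Srt} {x : ℕ} {A B : S.LType} (hx : (s, x) ∉ B.FV)
    (f : ∀ t : LTerm S.toLogicalSignature s,
      category.{u, v, w}.Hom (mk B) (mk (LForm.subst x t A))) :
    Inhab S {(B, 0)} (LForm.all s x A) := by
  refine .all_intro (by rintro y rfl; exact hx) ?_
  have := inhab_of_hom (f (.fvar x)) (inhab_self B)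
  exact LForm.subst_fvar_self x A ▸ this

/-- ∃-elimination with `x` as both eigenvariable and witness. It is permitted because the parameter
of type `A` does not mention `x`, and neither does the target, where `x` is bound. -/
lemma inhab_ex_and {s : S.Srt} {x : ℕ} {A B : S.LType} (hA : (s, x) ∉ A.FV) :
    Inhab S {(.and A (LForm.ex s x B), 0)} (LForm.ex s x (.and A B)) := by
  have h : Inhab S {(A, 0)} (.imp B (LForm.ex s x (.and A B))) :=
    .imp_intro 1 (.ex_intro (.fvar x) (by
      rw [LForm.subst_fvar_self]
      exact .and_intro (.var (.inr rfl)) .hyp))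
  have h' : Inhab S {(A, 0), (LForm.ex s x B, 1)} (LForm.ex s x (.and A B)) :=
    (Inhab.ex_elim (P := {(LForm.ex s x B, 1)}) (by rintro y rfl; exact hA)
      (LForm.not_mem_FV_ex s x _) (.var rfl) h).mono (by simp)
  have h'' : Inhab S ∅ (.imp (LForm.ex s x B) (.imp A (LForm.ex s x (.and A B)))) :=
    .imp_intro 1 (.imp_intro 0 (by simpa using h'))
  exact (h''.of_empty.imp_elim (inhab_self _).and_right).imp_elim (inhab_self _).and_left

/-- The model whose arrows record derivability. -/
noncomputable def model : @SigmaStructure S (TermCat.{u, w} S) category.{u, v, w}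
    cartesian hasFiniteCoproducts closed where
  distrib := thin_distrib
  obj := mk
  zeroIso := thinIso (homMk (Inhab.bot_imp.imp_elim (inhab_self _))) (initial.to _)
  oneIso := Iso.refl _
  prodIso _ _ := Iso.refl _
  sumIso A B := thinIso
    (homMk ((inhab_self _).or_elim
      (coprod.inl : mk A ⟶ mk A ⨿ mk B).down.down.of_empty
      (coprod.inr : mk B ⟶ mk A ⨿ mk B).down.down.of_empty))
    (coprod.desc (homMk (inhab_self _).or_left) (homMk (inhab_self _).or_right))
  expIso _ _ := Iso.refl _
  allProj _ _ _ t := homMk ((inhab_self _).all_elim t)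
  all_terminal _ _ _ _ hx f :=
    ⟨homMk (exists_all_lift hx f), fun _ => Subsingleton.elim _ _,
      fun _ _ => Subsingleton.elim _ _⟩
  exInj _ _ _ t := homMk (.ex_intro t (inhab_self _))
  ex_initial s x A B hx f := by
    refine ⟨homMk ?_, fun _ => Subsingleton.elim _ _, fun _ _ => Subsingleton.elim _ _⟩
    -- As for `∀`, the component at the variable `x` determines enough: it is the premise of
    -- ∃-elimination.
    have h : Inhab S ∅ (.imp (LForm.subst x (.fvar x : LTerm S.toLogicalSignature s) A) B) :=
      (f (.fvar x)).down.down
    rw [LForm.subst_fvar_self] at h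
    exact (Inhab.ex_elim (fun y hy => hy.elim) hx (inhab_self _) h).mono
      (Set.union_empty _).subset
  ex_distrib s x A B hA _ _ := thin_isIso _ (homMk (inhab_ex_and hA))
  axHom a := homMk ((Inhab.axiom_imp a).imp_elim (inhab_self _))

end TermCat

end TermModel

/-! ### Soundness in an arbitrary model -/

section Soundness

variable {S : LambdaSignature.{u}} {C : Type w} [Category.{v} C]
  [CartesianMonoidalCategory C] [HasFiniteCoproducts C] [MonoidalClosed C]

namespace LogicallyDistributive

variable (N : LogicallyDistributive S C)

/-- There is an arrow `N A ⟶ N B`. -/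
def Entails (A B : S.LType) : Prop := Nonempty (N.obj A ⟶ N.obj B)

variable {N} {A B D E : S.LType}

lemma Entails.refl (A : S.LType) : N.Entails A A := ⟨𝟙 _⟩

lemma Entails.trans : N.Entails A B → N.Entails B D → N.Entails A D :=
  fun ⟨f⟩ ⟨g⟩ => ⟨f ≫ g⟩

lemma Entails.pair : N.Entails D A → N.Entails D B → N.Entails D (.and A B) :=
  fun ⟨f⟩ ⟨g⟩ => ⟨CartesianMonoidalCategory.lift f g ≫ (N.prodIso A B).inv⟩

lemma entails_fst : N.Entails (.and A B) A :=
  ⟨(N.prodIso A B).hom ≫ CartesianMonoidalCategory.fst _ _⟩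

lemma entails_snd : N.Entails (.and A B) B :=
  ⟨(N.prodIso A B).hom ≫ CartesianMonoidalCategory.snd _ _⟩

lemma entails_inl : N.Entails A (.or A B) := ⟨coprod.inl ≫ (N.sumIso A B).inv⟩

lemma entails_inr : N.Entails B (.or A B) := ⟨coprod.inr ≫ (N.sumIso A B).inv⟩

lemma Entails.desc : N.Entails A D → N.Entails B D → N.Entails (.or A B) D :=
  fun ⟨f⟩ ⟨g⟩ => ⟨(N.sumIso A B).hom ≫ coprod.desc f g⟩

lemma entails_top : N.Entails A .top :=
  ⟨CartesianMonoidalCategory.toUnit _ ≫ N.oneIso.inv⟩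

lemma bot_entails : N.Entails .bot A := ⟨N.zeroIso.hom ≫ initial.to _⟩

lemma Entails.curry : N.Entails (.and A D) B → N.Entails D (.imp A B) :=
  fun ⟨f⟩ => ⟨MonoidalClosed.curry ((N.prodIso A D).inv ≫ f) ≫ (N.expIso A B).inv⟩

lemma Entails.uncurry : N.Entails D (.imp A B) → N.Entails (.and A D) B :=
  fun ⟨f⟩ => ⟨(N.prodIso A D).hom ≫ MonoidalClosed.uncurry (f ≫ (N.expIso A B).hom)⟩

lemma Entails.app (h : N.Entails D (.imp A B)) (k : N.Entails D A) : N.Entails D B :=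
  (k.pair (.refl D)).trans h.uncurry

lemma Entails.swap (h : N.Entails D (.imp A B)) : N.Entails A (.imp D B) :=
  .curry ((entails_snd.pair entails_fst).trans h.uncurry)

/-- The context is exchanged with the case hypothesis by `Entails.swap`, so that plain copairing
into `D → E` applies; evaluation at `D` finishes. -/
lemma Entails.cases (h : N.Entails D (.or A B)) (k : N.Entails D (.imp A E))
    (l : N.Entails D (.imp B E)) : N.Entails D E :=
  (h.trans (k.swap.desc l.swap)).app (.refl D)

/-- The family of instances carries no compatibility conditions, so arbitrarily chosen arrows
already form a cone. -/
lemma entails_all {s : S.Srt} {x : ℕ} (hx : (s, x) ∉ D.FV)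
    (h : ∀ t : LTerm S.toLogicalSignature s, N.Entails D (LForm.subst x t A)) :
    N.Entails D (LForm.all s x A) :=
  let ⟨g, _⟩ := N.all_terminal s x A D hx fun t => (h t).some
  ⟨g⟩

lemma all_entails {s : S.Srt} (x : ℕ) (t : LTerm S.toLogicalSignature s) :
    N.Entails (LForm.all s x A) (LForm.subst x t A) :=
  ⟨N.allProj s x A t⟩

lemma entails_ex {s : S.Srt} (x : ℕ) (t : LTerm S.toLogicalSignature s) :
    N.Entails (LForm.subst x t A) (LForm.ex s x A) :=
  ⟨N.exInj s x A t⟩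

lemma ex_entails {s : S.Srt} {x : ℕ} (hx : (s, x) ∉ D.FV)
    (h : ∀ t : LTerm S.toLogicalSignature s, N.Entails (LForm.subst x t A) D) :
    N.Entails (LForm.ex s x A) D :=
  let ⟨g, _⟩ := N.ex_initial s x A D hx fun t => (h t).some
  ⟨g⟩

end LogicallyDistributive

open LogicallyDistributive

/-- Soundness of λ-terms, for all substitution instances. -/
theorem LamTerm.entails_sub (N : SigmaStructure S C) {V : Set S.TVar} {A : S.LType}
    (t : LamTerm S V A) :
    ∀ (σ : ∀ s, ℕ → LTerm S.toLogicalSignature s) (D : S.LType),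
      (∀ y ∈ V, N.Entails D (y.1.sub σ)) → N.Entails D (A.sub σ) := by
  induction t with
  | var A n => exact fun σ D h => h _ rfl
  | ax a t ih =>
    intro σ D h
    have := ih σ D h
    rw [axDom_sub] at this
    rw [axCod_sub]
    exact this.trans ⟨N.axHom a⟩
  | pair r t ih ih' =>
    exact fun σ D h => (ih σ D fun y hy => h y (.inl hy)).pair (ih' σ D fun y hy => h y (.inr hy))
  | fst t ih => exact fun σ D h => (ih σ D h).trans entails_fst
  | snd t ih => exact fun σ D h => (ih σ D h).trans entails_snd
  | inl B t ih => exact fun σ D h => (ih σ D h).trans entails_inl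
  | inr B t ih => exact fun σ D h => (ih σ D h).trans entails_inr
  | when r t t' ih ih' ih'' =>
    exact fun σ D h => (ih σ D fun y hy => h y (.inl (.inl hy))).cases
      (ih' σ D fun y hy => h y (.inl (.inr hy))) (ih'' σ D fun y hy => h y (.inr hy))
  | lam A n t ih =>
    refine fun σ D h => .curry (ih σ _ fun y hy => ?_)
    by_cases hy' : y = (A, n)
    · subst hy'
      exact entails_fst
    · exact entails_snd.trans (h y ⟨hy, hy'⟩)
  | app r t ih ih' =>
    exact fun σ D h => (ih σ D fun y hy => h y (.inl hy)).app (ih' σ D fun y hy => h y (.inr hy))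
  | star => exact fun _ _ _ => entails_top
  | absurd A => exact fun _ _ _ => .curry (entails_fst.trans bot_entails)
  | @allI V A s x t hx ih =>
    intro σ D h
    obtain ⟨z, hz, hzD⟩ := exists_fresh σ s x A D.finite_FV
    rw [LForm.all_sub hz]
    -- Every instance `r` must be reached; the induction hypothesis at `σ` changed at `x` to `r`
    -- gives it, and the context is unaffected because `x` is not free in the types of `V`.
    refine entails_all hzD fun r => ?_
    rw [LForm.subst_sub_update hz]
    refine ih _ D fun y hy => ?_
    rw [LForm.sub_update_of_not_mem _ _ (hx y hy)]
    exact h y hy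
  | @allE V A s x t r ih =>
    intro σ D h
    obtain ⟨z, hz, -⟩ := exists_fresh σ s x A Set.finite_empty
    have := ih σ D h
    rw [LForm.all_sub hz] at this
    rw [LForm.sub_subst, ← LForm.subst_sub_update hz]
    exact this.trans (all_entails _ _)
  | @exI V A s x r t ih =>
    intro σ D h
    obtain ⟨z, hz, -⟩ := exists_fresh σ s x A Set.finite_empty
    have := ih σ D h
    rw [LForm.sub_subst, ← LForm.subst_sub_update hz] at this
    rw [LForm.ex_sub hz]
    exact this.trans (entails_ex _ _)
  | @exE V W A B s x t r hx hB ih ih' =>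
    intro σ D h
    obtain ⟨z, hz, hzD⟩ := exists_fresh σ s x A (D.finite_FV.union (B.sub σ).finite_FV)
    have h1 := ih σ D fun y hy => h y (.inl hy)
    rw [LForm.ex_sub hz] at h1
    -- The cocone has vertex `D → Bσ`, which absorbs the context; `z` was chosen fresh for both `D`
    -- and `Bσ`, as the universal property demands of its vertex.
    refine (h1.trans (ex_entails (D := .imp D (B.sub σ)) hzD fun q => ?_)).app (.refl D)
    rw [LForm.subst_sub_update hz, ← LForm.sub_update_of_not_mem σ q hB]
    refine (ih' (update σ x q) D fun y hy => ?_).swap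
    rw [LForm.sub_update_of_not_mem _ _ (hx y hy)]
    exact h y (.inr hy)

theorem HasTermInContext.entails {B A : S.LType} (h : HasTermInContext S B A)
    (N : SigmaStructure S C) : Nonempty (N.obj B ⟶ N.obj A) := by
  obtain ⟨x, V, t, hV⟩ := h
  have := t.entails_sub N (fun _ n => .fvar n) B fun y hy => by
    obtain rfl := hV hy
    rw [LForm.sub_fvar]
    exact .refl _
  rwa [LForm.sub_fvar] at this

end Soundness

/-! ### Assembly of the equivalences -/

theorem logicalConsequence_iff_hasTermInContext (S : LambdaSignature.{u}) (Bs : List S.LType)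
    (A : S.LType) : LogicalConsequence.{u, v, w} S Bs A ↔
      HasTermInContext S (LForm.prod Bs) A := by
  constructor
  · intro h
    obtain ⟨f⟩ := @h (TermCat.{u, w} S) TermCat.category TermCat.cartesian
      TermCat.hasFiniteCoproducts TermCat.closed TermCat.model
    exact hasTermInContext_iff.2 f.down.down
  · exact fun h C _ _ _ _ N => h.entails N

end FirstOrderLD

theorem corollary6p17 (S : FirstOrderLD.LambdaSignature.{u}) (Bs : List S.LType) (A : S.LType) :
    (FirstOrderLD.LogicalConsequence.{u, v, w} S Bs A ↔
      FirstOrderLD.HasTermInContext S (FirstOrderLD.LForm.prod Bs) A) ∧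
    (FirstOrderLD.LogicalConsequence.{u, v, w} S Bs A ↔
      FirstOrderLD.Proves S (Bs : Multiset S.LType) A) :=
  have h := FirstOrderLD.logicalConsequence_iff_hasTermInContext S Bs A
  ⟨h, h.trans FirstOrderLD.hasTermInContext_prod_iff_proves⟩
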